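/- Let $K$ be a field, $S=K[x_1,\ldots,x_n]$, and let $\alpha=(k_1,\ldots,k_n)$ be a vector of positive integers. Let $S^\alpha=K[x_{ij} : 1\le i\le n,\ 1\le j\le k_i]$ and $P_i=(x_{i1},\ldots,x_{ik_i})\subset S^\alpha$. For a monomial ideal $I$ let $G(I)$ denote its set of minimal monomial generators. The expansion of a monomial ideal $I\subset S$ is $I^\alpha=\sum_{\mathbf x^{\mathbf a}\in G(I)}P_1^{\mathbf a(1)}\cdots P_n^{\mathbf a(n)}\subset S^\alpha$, and the expansion of a set $\mathcal A$ of monomials of $S$ is $\mathcal A^\alpha=\bigcup_{\mathbf x^{\mathbf u}\in\mathcal A}G\big((\mathbf x^{\mathbf u})^\alpha\big)$. For a set $\mathcal B$ of monomials in a polynomial ring over $K$, the toric ring $K[\mathcal B]$ is the $K$-subalgebra generated by $\mathcal B$. Let $\mathcal A=\{u_1,\ldots,u_m\}$ be a finite set of monomials of $S$. Then $K[\mathcal A]$ is normal (that is, integrally closed in its field of fractions) if and only if $K[\mathcal A^\alpha]$ is normal. -/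

import Mathlib

noncomputable section

namespace Expansion

/-- The toric ring `K[A]`: the `K`-subalgebra of the polynomial ring generated by the monomials
`x ^ u`, `u ∈ A`. A set of monomials is given by the set `A` of its exponent vectors. -/
def toricRing {σ : Type*} (K : Type*) [Field K] (A : Set (σ →₀ ℕ)) :
    Subalgebra K (MvPolynomial σ K) :=
  Algebra.adjoin K ((fun u => MvPolynomial.monomial u (1 : K)) '' A)

/-- `G(I)` for a monomial ideal `I`: the exponent vectors of the monomials that lie in `I` and are
minimal with respect to divisibility (the componentwise order on exponent vectors). -/
def minimalGenerators {σ : Type*} {K : Type*} [Field K] (I : Ideal (MvPolynomial σ K)) :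
    Set (σ →₀ ℕ) :=
  {w | Minimal (fun v => MvPolynomial.monomial v (1 : K) ∈ I) w}

/-- Index set of the variables `x_{ij}`, `1 ≤ i ≤ n`, `1 ≤ j ≤ α i`. -/
abbrev ExpandedVars {n : ℕ} (α : Fin n → ℕ) : Type := Σ i : Fin n, Fin (α i)

/-- The prime monomial ideal `P_j = (x_{j1}, …, x_{jk_j})`, where `k_j = α j`. -/
def blockIdeal {n : ℕ} (K : Type*) [Field K] (α : Fin n → ℕ) (j : Fin n) :
    Ideal (MvPolynomial (ExpandedVars α) K) :=
  Ideal.span (Set.range fun k : Fin (α j) => MvPolynomial.X ⟨j, k⟩)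

/-- The expansion `I^α = ∑_{x^a ∈ G(I)} P_1^{a(1)} ⋯ P_n^{a(n)}` of a monomial ideal `I`. -/
def expandIdeal {n : ℕ} {K : Type*} [Field K] (α : Fin n → ℕ)
    (I : Ideal (MvPolynomial (Fin n) K)) : Ideal (MvPolynomial (ExpandedVars α) K) :=
  ⨆ a ∈ minimalGenerators I, ∏ j, blockIdeal K α j ^ a j

/-- The expansion `A^α = ⋃_{x^u ∈ A} G((x^u)^α)` of a set of monomials. -/
def expandSet {n : ℕ} (K : Type*) [Field K] (α : Fin n → ℕ) (A : Set (Fin n →₀ ℕ)) :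
    Set (ExpandedVars α →₀ ℕ) :=
  ⋃ u ∈ A, minimalGenerators (expandIdeal α (Ideal.span {MvPolynomial.monomial u (1 : K)}))

end Expansion

end

namespace Expansion

open MvPolynomial

universe u

/-! Normality of a toric ring depends only on the monoid of its exponents:
`isIntegrallyClosed_toricRing_iff` shows that `K[A]` is normal iff the monoid spanned by the finite
set `A` is. On the expanded side, let `blockDegree` send each `x_{ij}` to `x_i`. The minimal
generators of `(x^u)^α` are exactly the monomials of multidegree `u`, so `A^α` is the preimage of
`A` (`expandSet_eq_preimage`). Factorizations of multidegrees lift to monomials, so the monoid of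
`A^α` is the preimage of that of `A` (`closure_blockDegree_preimage`). Normality passes to
preimages, and comes back along a section of `blockDegree`. -/

/-- An additive submonoid `M` of `ℕ^σ` is normal if it contains every vector of the group it
generates having a positive multiple in `M`. Such a vector automatically lies in `ℕ^σ`. -/
def IsNormalMonoid {σ : Type*} (M : AddSubmonoid (σ →₀ ℕ)) : Prop :=
  ∀ w a : σ →₀ ℕ, a ∈ M → a + w ∈ M → ∀ k : ℕ, 0 < k → k • w ∈ M → w ∈ M

/-! ### Normality of toric rings and of their exponent monoids -/

/-- A subalgebra of an integrally closed domain `T` is integrally closed iff it contains all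
elements of `T` that are integral over it and lie in its field of fractions. -/
theorem isIntegrallyClosed_subalgebra_iff {K T : Type*} [Field K] [CommRing T] [IsDomain T]
    [Algebra K T] [IsIntegrallyClosed T] (S : Subalgebra K T) :
    IsIntegrallyClosed S ↔
      ∀ f : T, IsIntegral S f → ∀ h ∈ S, h ≠ 0 → h * f ∈ S → f ∈ S := by
  let F := FractionRing S
  let L := FractionRing T
  have hSL : Function.Injective (algebraMap S L) := by
    rw [IsScalarTower.algebraMap_eq S T L]
    exact (IsFractionRing.injective T L).comp Subtype.val_injective
  have : FaithfulSMul S L := (faithfulSMul_iff_algebraMap_injective S L).2 hSL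
  let : Algebra F L := FractionRing.liftAlgebra S L
  have : IsScalarTower S F L := FractionRing.isScalarTower_liftAlgebra S L
  have hFL : Function.Injective (algebraMap F L) := (algebraMap F L).injective
  have hTL : Function.Injective (algebraMap T L) := IsFractionRing.injective T L
  have hval : ∀ s : S, algebraMap F L (algebraMap S F s) = algebraMap T L (s : T) := by
    intro s
    rw [← IsScalarTower.algebraMap_apply S F L, IsScalarTower.algebraMap_apply S T L]
    rfl
  rw [isIntegrallyClosed_iff F]
  constructor
  · intro H f hf h hS h0 hfS
    have hh : algebraMap T L h ≠ 0 := by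
      rwa [Ne, map_eq_zero_iff _ hTL]
    have hx : algebraMap F L (algebraMap S F ⟨h * f, hfS⟩ / algebraMap S F ⟨h, hS⟩) =
        algebraMap T L f := by
      rw [map_div₀, hval, hval]
      simp only [map_mul]
      exact mul_div_cancel_left₀ _ hh
    obtain ⟨y, hy⟩ := H (x := algebraMap S F ⟨h * f, hfS⟩ / algebraMap S F ⟨h, hS⟩) (by
      rw [← isIntegral_algebraMap_iff hFL, hx]
      exact hf.algebraMap)
    rw [← hy, hval] at hx
    rw [← hTL hx]
    exact y.2
  · intro H x hx
    have hxL : IsIntegral S (algebraMap F L x) := hx.algebraMap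
    -- As `T` is integrally closed, `x` is already an element `f` of `T`.
    obtain ⟨f, hf⟩ := (isIntegrallyClosed_iff L).1 ‹IsIntegrallyClosed T›
      (hxL.tower_top (A := T))
    obtain ⟨a, b, hb, rfl⟩ := IsFractionRing.div_surjective (A := S) x
    have hb0 : (b : T) ≠ 0 := fun h => nonZeroDivisors.ne_zero hb (Subtype.ext h)
    have hbL : algebraMap T L (b : T) ≠ 0 := by rwa [Ne, map_eq_zero_iff _ hTL]
    have hfS : f ∈ S := by
      refine H f ?_ b b.2 hb0 ?_
      · rwa [← hf, isIntegral_algebraMap_iff hTL] at hxL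
      · have : (b : T) * f = a := by
          apply hTL
          rw [map_mul, hf, map_div₀, hval, hval, mul_comm]
          exact div_mul_cancel₀ _ hbL
        rw [this]
        exact a.2
    exact ⟨⟨f, hfS⟩, hFL (by rw [hval, hf])⟩

/-- The toric ring consists of the polynomials supported on the monoid spanned by `A`. -/
theorem mem_toricRing_iff {σ K : Type*} [Field K] {A : Set (σ →₀ ℕ)} {p : MvPolynomial σ K} :
    p ∈ toricRing K A ↔ ∀ w ∈ p.support, w ∈ AddSubmonoid.closure A := by
  classical
  constructor
  · intro hp
    induction hp using Algebra.adjoin_induction with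
    | mem x hx =>
      obtain ⟨u, hu, rfl⟩ := hx
      intro w hw
      rw [Finset.mem_singleton.1 (support_monomial_subset hw)]
      exact AddSubmonoid.subset_closure hu
    | algebraMap r =>
      intro w hw
      rw [Finset.mem_singleton.1 (support_monomial_subset hw)]
      exact zero_mem _
    | add x y _ _ hx hy =>
      intro w hw
      exact (Finset.mem_union.1 (support_add hw)).elim (hx w) (hy w)
    | mul x y _ _ hx hy =>
      intro w hw
      obtain ⟨a, ha, b, hb, rfl⟩ := Finset.mem_add.1 (support_mul x y hw)
      exact add_mem (hx a ha) (hy b hb)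
  · intro hp
    have hmon : ∀ w ∈ AddSubmonoid.closure A, monomial w (1 : K) ∈ toricRing K A := by
      intro w hw
      induction hw using AddSubmonoid.closure_induction with
      | mem x hx => exact Algebra.subset_adjoin ⟨x, hx, rfl⟩
      | zero => exact one_mem _
      | add x y _ _ hx hy =>
        have := mul_mem hx hy
        rwa [monomial_mul, one_mul] at this
    rw [p.as_sum]
    refine sum_mem fun w hw => ?_
    have := Subalgebra.smul_mem _ (hmon w (hp w hw)) (coeff w p)
    rwa [smul_monomial, smul_eq_mul, mul_one] at this

theorem monomial_mem_toricRing_iff {σ K : Type*} [Field K] {A : Set (σ →₀ ℕ)} {w : σ →₀ ℕ} :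
    monomial w (1 : K) ∈ toricRing K A ↔ w ∈ AddSubmonoid.closure A := by
  classical
  rw [mem_toricRing_iff]
  simp [support_monomial]

/-- If a translate of the ray spanned by `w` lies in a finitely generated monoid, then a positive
multiple of `w` lies in the monoid. -/
theorem exists_nsmul_mem_closure {M : Type*} [AddCommMonoid M] [IsCancelAdd M] {A : Set M} (hA : A.Finite)
    {a w : M} (h : ∀ k : ℕ, a + k • w ∈ AddSubmonoid.closure A) :
    ∃ k : ℕ, 0 < k ∧ k • w ∈ AddSubmonoid.closure A := by
  have := hA.fintype
  simp only [AddSubmonoid.mem_closure_iff_of_fintype] at h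
  choose c hc using h
  -- Dickson's lemma: among the coefficient vectors of the `a + k • w`, some `c i ≤ c j` with `i <
  -- j`. Their difference expresses `(j - i) • w`.
  obtain ⟨i, j, hij, hle⟩ := wellQuasiOrdered_le (α := A → ℕ) c
  refine ⟨j - i, Nat.sub_pos_of_lt hij, AddSubmonoid.mem_closure_iff_of_fintype.2
    ⟨fun s => c j s - c i s, ?_⟩⟩
  apply add_left_cancel (a := a + i • w)
  rw [add_assoc, ← add_nsmul, Nat.add_sub_cancel' hij.le, hc i, hc j,
    ← Finset.sum_add_distrib]
  refine Finset.sum_congr rfl fun s _ => ?_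
  rw [← add_nsmul, Nat.add_sub_cancel' (hle s)]

theorem nonempty_monomialOrder (σ : Type u) [Finite σ] : Nonempty (MonomialOrder.{u, u} σ) := by
  classical
  let : LinearOrder σ := linearOrderOfSTO WellOrderingRel
  exact ⟨MonomialOrder.lex⟩

/-- The leading exponent of a polynomial integral over a toric ring and contained in its field of
fractions belongs to the monoid, provided the latter is normal. -/
theorem degree_mem_closure {σ K : Type*} [Field K] {A : Set (σ →₀ ℕ)}
    (hA : A.Finite) (hN : IsNormalMonoid (AddSubmonoid.closure A)) (m : MonomialOrder σ)
    {f h : MvPolynomial σ K} (hf : IsIntegral (toricRing K A) f) (hf0 : f ≠ 0)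
    (hh : h ∈ toricRing K A) (h0 : h ≠ 0) (hfh : h * f ∈ toricRing K A) :
    m.degree f ∈ AddSubmonoid.closure A := by
  -- Almost integrality: one nonzero `r` has `r * f ^ k` in the toric ring for all `k`. Taking
  -- leading exponents puts a translated ray in the monoid.
  obtain ⟨r, hr, H⟩ := hf.isAlmostIntegral_of_exists_smul_mem_range
    ⟨⟨h, hh⟩, mem_nonZeroDivisors_of_ne_zero (fun e => h0 (congrArg Subtype.val e)),
      ⟨⟨h * f, hfh⟩, rfl⟩⟩
  have hr0 : (r : MvPolynomial σ K) ≠ 0 := fun e => nonZeroDivisors.ne_zero hr (Subtype.ext e)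
  have hk : ∀ k : ℕ, m.degree (r : MvPolynomial σ K) + k • m.degree f ∈
      AddSubmonoid.closure A := by
    intro k
    obtain ⟨s, hs⟩ := H k
    have hs' : (s : MvPolynomial σ K) = r * f ^ k := hs
    have hmem := mem_toricRing_iff.1 s.2 (m.degree (s : MvPolynomial σ K))
      (m.degree_mem_support (by rw [hs']; exact mul_ne_zero hr0 (pow_ne_zero k hf0)))
    rwa [hs', m.degree_mul hr0 (pow_ne_zero k hf0), m.degree_pow] at hmem
  obtain ⟨k, hk0, hkm⟩ := exists_nsmul_mem_closure hA hk
  exact hN _ _ (by simpa using hk 0) (by simpa using hk 1) k hk0 hkm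

/-- Induction on the number of terms: the leading term lies in the toric ring by
`degree_mem_closure`, so subtracting it preserves all hypotheses. -/
theorem mem_toricRing_of_isIntegral {σ K : Type*} [Field K] {A : Set (σ →₀ ℕ)}
    (hA : A.Finite) (hN : IsNormalMonoid (AddSubmonoid.closure A)) (m : MonomialOrder σ)
    {h : MvPolynomial σ K} (hh : h ∈ toricRing K A) (h0 : h ≠ 0) :
    ∀ (N : ℕ) (f : MvPolynomial σ K), f.support.card ≤ N → IsIntegral (toricRing K A) f →
      h * f ∈ toricRing K A → f ∈ toricRing K A := by
  classical
  intro N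
  induction N with
  | zero =>
    intro f hc _ _
    have : f = 0 := by simpa using hc
    rw [this]
    exact zero_mem _
  | succ N ih =>
    intro f hc hf hfh
    by_cases hf0 : f = 0
    · rw [hf0]
      exact zero_mem _
    set t : MvPolynomial σ K := monomial (m.degree f) (coeff (m.degree f) f) with ht
    have htS : t ∈ toricRing K A := by
      rw [mem_toricRing_iff]
      intro w hw
      rw [Finset.mem_singleton.1 (support_monomial_subset hw)]
      exact degree_mem_closure hA hN m hf hf0 hh h0 hfh
    have hsub : f - t ∈ toricRing K A := by
      apply ih
      · have hss : (f - t).support ⊆ f.support.erase (m.degree f) := by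
          intro w hw
          rw [mem_support_iff, ht, coeff_sub, coeff_monomial] at hw
          rw [Finset.mem_erase, mem_support_iff]
          by_cases e : m.degree f = w
          · subst e
            simp at hw
          · rw [if_neg e, sub_zero] at hw
            exact ⟨Ne.symm e, hw⟩
        have h1 := Finset.card_le_card hss
        rw [Finset.card_erase_of_mem (m.degree_mem_support hf0)] at h1
        omega
      · exact hf.sub (isIntegral_algebraMap (x := (⟨t, htS⟩ : toricRing K A)))
      · rw [mul_sub]
        exact sub_mem hfh (mul_mem hh htS)
    simpa using add_mem hsub htS

/-- The toric ring of a finite set of monomials is normal iff the monoid they span is normal. -/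
theorem isIntegrallyClosed_toricRing_iff {σ K : Type*} [Finite σ] [Field K] {A : Set (σ →₀ ℕ)}
    (hA : A.Finite) :
    IsIntegrallyClosed (toricRing K A) ↔ IsNormalMonoid (AddSubmonoid.closure A) := by
  rw [isIntegrallyClosed_subalgebra_iff]
  constructor
  · intro H w a ha haw k hk hkw
    rw [← monomial_mem_toricRing_iff (K := K)] at ha haw hkw ⊢
    refine H _ ?_ (monomial a 1) ha (by simp) (by rwa [monomial_mul, one_mul])
    refine IsIntegral.of_pow hk ?_
    rw [monomial_pow, one_pow]
    exact isIntegral_algebraMap (x := (⟨_, hkw⟩ : toricRing K A))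
  · intro hN f hf h hh h0 hfh
    obtain ⟨m⟩ := nonempty_monomialOrder σ
    exact mem_toricRing_of_isIntegral hA hN m hh h0 _ f le_rfl hf hfh

/-! ### Multidegrees of monomials of `S^α` -/

/-- The multidegree of a monomial of `S^α`, where each `x_{ij}` has the degree of `x_i`. -/
noncomputable def blockDegree {n : ℕ} (α : Fin n → ℕ) : (ExpandedVars α →₀ ℕ) →+ (Fin n →₀ ℕ) :=
  Finsupp.mapDomain.addMonoidHom Sigma.fst

variable {n : ℕ} {α : Fin n → ℕ}

@[simp]
theorem blockDegree_single (p : ExpandedVars α) (k : ℕ) :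
    blockDegree α (Finsupp.single p k) = Finsupp.single p.1 k :=
  Finsupp.mapDomain_single

theorem blockDegree_mono {v w : ExpandedVars α →₀ ℕ} (h : v ≤ w) :
    blockDegree α v ≤ blockDegree α w := by
  obtain ⟨c, rfl⟩ := exists_add_of_le h
  rw [map_add]
  exact le_self_add

theorem le_blockDegree (w : ExpandedVars α →₀ ℕ) (p : ExpandedVars α) :
    w p ≤ blockDegree α w p.1 := by
  have h : Finsupp.single p (w p) ≤ w := by simp
  simpa using blockDegree_mono h p.1

theorem eq_zero_of_blockDegree_eq_zero {w : ExpandedVars α →₀ ℕ} (h : blockDegree α w = 0) :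
    w = 0 := by
  ext p
  have := le_blockDegree w p
  rw [h] at this
  simpa using this

theorem eq_of_le_of_blockDegree_le {v w : ExpandedVars α →₀ ℕ} (hvw : v ≤ w)
    (h : blockDegree α w ≤ blockDegree α v) : v = w := by
  obtain ⟨c, rfl⟩ := exists_add_of_le hvw
  have h0 : blockDegree α c = 0 := by
    rw [map_add] at h
    have : blockDegree α v + blockDegree α c ≤ blockDegree α v + 0 := by simpa using h
    exact le_antisymm (le_of_add_le_add_left this) bot_le
  rw [eq_zero_of_blockDegree_eq_zero h0, add_zero]

/-- A variable of block `i` divides every monomial of positive degree in block `i`. -/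
theorem exists_single_le {w : ExpandedVars α →₀ ℕ} {i : Fin n} (h : 1 ≤ blockDegree α w i) :
    ∃ k : Fin (α i), Finsupp.single ⟨i, k⟩ 1 ≤ w := by
  classical
  induction w using Finsupp.induction_linear with
  | zero => simp at h
  | add f g hf hg =>
    rw [map_add, Finsupp.add_apply] at h
    rcases Nat.eq_zero_or_pos (blockDegree α f i) with h0 | h0
    · obtain ⟨k, hk⟩ := hg (by omega)
      exact ⟨k, hk.trans le_add_self⟩
    · obtain ⟨k, hk⟩ := hf h0
      exact ⟨k, hk.trans le_self_add⟩
  | single p m =>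
    obtain ⟨j, k⟩ := p
    rw [blockDegree_single, Finsupp.single_apply] at h
    split_ifs at h with hj
    · dsimp only at hj
      subst hj
      exact ⟨k, Finsupp.single_mono h⟩
    · omega

/-- Removing a variable of block `i` from a monomial whose multidegree is at least `u + e_i`. -/
theorem exists_eq_add_single {w : ExpandedVars α →₀ ℕ} {u : Fin n →₀ ℕ} {i : Fin n}
    (h : u + Finsupp.single i 1 ≤ blockDegree α w) :
    ∃ (v : ExpandedVars α →₀ ℕ) (k : Fin (α i)),
      w = v + Finsupp.single ⟨i, k⟩ 1 ∧ u ≤ blockDegree α v := by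
  have hi : 1 ≤ blockDegree α w i := by
    have := h i
    simp at this
    omega
  obtain ⟨k, hk⟩ := exists_single_le hi
  obtain ⟨v, rfl⟩ := exists_add_of_le hk
  refine ⟨v, k, add_comm _ _, ?_⟩
  rw [map_add, blockDegree_single, add_comm u] at h
  exact le_of_add_le_add_left h

theorem finsupp_induction_add_one {σ : Type*} {P : (σ →₀ ℕ) → Prop} (h0 : P 0)
    (h1 : ∀ u i, P u → P (u + Finsupp.single i 1)) (u : σ →₀ ℕ) : P u := by
  have key : ∀ v u : σ →₀ ℕ, P u → P (u + v) := by
    intro v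
    induction v using Finsupp.induction_linear with
    | zero => simp
    | add f g hf hg =>
      intro u hu
      rw [← add_assoc]
      exact hg _ (hf _ hu)
    | single i m =>
      induction m with
      | zero => simp
      | succ m ih =>
        intro u hu
        rw [Finsupp.single_add, ← add_assoc]
        exact h1 _ _ (ih _ hu)
  simpa using key u 0 h0

theorem exists_le_blockDegree_eq (u : Fin n →₀ ℕ) :
    ∀ w : ExpandedVars α →₀ ℕ, u ≤ blockDegree α w → ∃ v ≤ w, blockDegree α v = u := by
  induction u using finsupp_induction_add_one with
  | h0 => exact fun w _ => ⟨0, bot_le, map_zero _⟩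
  | h1 u i ih =>
    intro w hw
    obtain ⟨v, k, rfl, hv⟩ := exists_eq_add_single hw
    obtain ⟨v', hle, hv'⟩ := ih v hv
    exact ⟨v' + Finsupp.single ⟨i, k⟩ 1, by gcongr, by rw [map_add, hv', blockDegree_single]⟩

/-! ### Generators of the expansion -/

/-- The ideal of `S^α` spanned by the monomials of multidegree at least `u`. -/
noncomputable def degreeIdeal (K : Type*) [Field K] (α : Fin n → ℕ) (u : Fin n →₀ ℕ) :
    Ideal (MvPolynomial (ExpandedVars α) K) :=
  Ideal.span ((fun v => monomial v (1 : K)) '' {v | u ≤ blockDegree α v})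

theorem monomial_mem_degreeIdeal_iff {K : Type*} [Field K] {u : Fin n →₀ ℕ}
    {w : ExpandedVars α →₀ ℕ} :
    monomial w (1 : K) ∈ degreeIdeal K α u ↔ u ≤ blockDegree α w := by
  classical
  rw [degreeIdeal, mem_ideal_span_monomial_image]
  simp only [support_monomial, one_ne_zero, if_false, Finset.mem_singleton, forall_eq,
    Set.mem_ofPred_eq]
  exact ⟨fun ⟨v, hv, hvw⟩ => hv.trans (blockDegree_mono hvw), fun h => ⟨w, h, le_rfl⟩⟩

theorem degreeIdeal_mul_le (K : Type*) [Field K] (u v : Fin n →₀ ℕ) :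
    degreeIdeal K α u * degreeIdeal K α v ≤ degreeIdeal K α (u + v) := by
  unfold degreeIdeal
  rw [Ideal.span_mul_span', Ideal.span_le]
  rintro _ ⟨_, ⟨a, ha, rfl⟩, _, ⟨b, hb, rfl⟩, rfl⟩
  refine Ideal.subset_span ⟨a + b, ?_, by simp [monomial_mul]⟩
  rw [Set.mem_ofPred_eq, map_add]
  exact add_le_add ha hb

theorem blockIdeal_le (K : Type*) [Field K] (j : Fin n) :
    blockIdeal K α j ≤ degreeIdeal K α (Finsupp.single j 1) := by
  rw [blockIdeal, Ideal.span_le]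
  rintro _ ⟨k, rfl⟩
  exact monomial_mem_degreeIdeal_iff.2 (by simp)

theorem prod_blockIdeal_add_single (K : Type*) [Field K] (u : Fin n →₀ ℕ) (i : Fin n) :
    ∏ j, blockIdeal K α j ^ (u + Finsupp.single i 1 : Fin n →₀ ℕ) j =
      (∏ j, blockIdeal K α j ^ u j) * blockIdeal K α i := by
  classical
  simp only [Finsupp.add_apply, pow_add, Finset.prod_mul_distrib]
  congr 1
  rw [Finset.prod_eq_single i]
  · simp
  · intro j _ hj
    simp [hj.symm]
  · simp

theorem prod_blockIdeal_eq (K : Type*) [Field K] (u : Fin n →₀ ℕ) :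
    ∏ j, blockIdeal K α j ^ u j = degreeIdeal K α u := by
  apply le_antisymm
  · induction u using finsupp_induction_add_one with
    | h0 =>
      intro p _
      rw [(Ideal.eq_top_iff_one (degreeIdeal K α 0)).2 (monomial_mem_degreeIdeal_iff.2 bot_le)]
      trivial
    | h1 u i ih =>
      rw [prod_blockIdeal_add_single]
      exact (Ideal.mul_mono ih (blockIdeal_le K i)).trans (degreeIdeal_mul_le K _ _)
  · suffices ∀ w : ExpandedVars α →₀ ℕ, u ≤ blockDegree α w →
        monomial w (1 : K) ∈ ∏ j, blockIdeal K α j ^ u j by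
      rw [degreeIdeal, Ideal.span_le]
      rintro _ ⟨w, hw, rfl⟩
      exact this w hw
    induction u using finsupp_induction_add_one with
    | h0 =>
      intro w _
      simp only [Finsupp.zero_apply, pow_zero, Finset.prod_const_one]
      rw [Ideal.one_eq_top]
      trivial
    | h1 u i ih =>
      intro w hw
      obtain ⟨v, k, rfl, hv⟩ := exists_eq_add_single hw
      rw [prod_blockIdeal_add_single, ← one_mul (1 : K), ← monomial_mul]
      exact Ideal.mul_mem_mul (ih v hv) (Ideal.subset_span ⟨k, rfl⟩)

theorem minimalGenerators_span_monomial {σ K : Type*} [Field K] (u : σ →₀ ℕ) :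
    minimalGenerators (Ideal.span {monomial u (1 : K)}) = {u} := by
  ext w
  simp only [minimalGenerators, Ideal.mem_span_singleton, monomial_dvd_monomial, one_ne_zero,
    false_or, dvd_rfl, and_true, Set.mem_ofPred_eq, Set.mem_singleton_iff]
  constructor
  · intro h
    exact le_antisymm (h.le_of_le le_rfl h.prop) h.prop
  · rintro rfl
    exact ⟨le_rfl, fun _ h _ => h⟩

/-- A monomial of multidegree at least `u` has a divisor of multidegree exactly `u`, and
divisibility between monomials of equal multidegree is equality. -/
theorem minimalGenerators_expandIdeal (K : Type*) [Field K] (u : Fin n →₀ ℕ) :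
    minimalGenerators (expandIdeal α (Ideal.span {monomial u (1 : K)})) =
      {w | blockDegree α w = u} := by
  have hI : expandIdeal α (Ideal.span {monomial u (1 : K)}) = degreeIdeal K α u := by
    rw [expandIdeal, minimalGenerators_span_monomial]
    simp [prod_blockIdeal_eq]
  rw [hI]
  ext w
  simp only [minimalGenerators, monomial_mem_degreeIdeal_iff, Set.mem_ofPred_eq]
  constructor
  · intro h
    obtain ⟨v, hvw, rfl⟩ := exists_le_blockDegree_eq u w h.prop
    rw [le_antisymm hvw (h.le_of_le le_rfl hvw)]
  · rintro rfl
    exact ⟨le_rfl, fun v hv hvw => (eq_of_le_of_blockDegree_le hvw hv).ge⟩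

theorem expandSet_eq_preimage (K : Type*) [Field K] (A : Set (Fin n →₀ ℕ)) :
    expandSet K α A = blockDegree α ⁻¹' A := by
  ext w
  simp [expandSet, minimalGenerators_expandIdeal]

/-! ### Transfer of the monoid and its normality -/

theorem finite_blockDegree_preimage {A : Set (Fin n →₀ ℕ)} (hA : A.Finite) :
    (blockDegree α ⁻¹' A).Finite := by
  refine hA.preimage' fun u _ => ?_
  refine (Set.finite_Iic (Finsupp.equivFunOnFinite.symm fun p : ExpandedVars α => u p.1)).subset ?_
  rintro w rfl p
  exact le_blockDegree w p

theorem closure_blockDegree_preimage (A : Set (Fin n →₀ ℕ)) :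
    AddSubmonoid.closure (blockDegree α ⁻¹' A) =
      (AddSubmonoid.closure A).comap (blockDegree α) := by
  apply le_antisymm
  · rw [AddSubmonoid.closure_le]
    exact fun w hw => AddSubmonoid.subset_closure hw
  · suffices ∀ u ∈ AddSubmonoid.closure A, ∀ w, blockDegree α w = u →
        w ∈ AddSubmonoid.closure (blockDegree α ⁻¹' A) from fun w hw => this _ hw w rfl
    intro u hu
    induction hu using AddSubmonoid.closure_induction with
    | mem x hx =>
      rintro w rfl
      exact AddSubmonoid.subset_closure hx
    | zero =>
      intro w hw
      rw [eq_zero_of_blockDegree_eq_zero hw]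
      exact zero_mem _
    | add x y _ _ hx hy =>
      intro w hw
      -- Lift the splitting `x + y` of the multidegree to a factorization of `w`.
      obtain ⟨v, hvw, hv⟩ := exists_le_blockDegree_eq x w (hw ▸ le_self_add)
      obtain ⟨c, rfl⟩ := exists_add_of_le hvw
      rw [map_add, hv] at hw
      exact add_mem (hx v hv) (hy c (add_left_cancel hw))

/-- The monomials of `S` as monomials of `S^α` in the first variables of the blocks. -/
noncomputable def firstVars (hα : ∀ i, 1 ≤ α i) : (Fin n →₀ ℕ) →+ (ExpandedVars α →₀ ℕ) :=
  Finsupp.mapDomain.addMonoidHom fun i => ⟨i, ⟨0, hα i⟩⟩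

theorem blockDegree_firstVars (hα : ∀ i, 1 ≤ α i) (u : Fin n →₀ ℕ) :
    blockDegree α (firstVars hα u) = u :=
  (Finsupp.mapDomain_comp (f := fun i => (⟨i, ⟨0, hα i⟩⟩ : ExpandedVars α))
    (g := Sigma.fst)).symm.trans Finsupp.mapDomain_id

/-- Positivity of the `α i` enters here: it provides the additive section `firstVars`. -/
theorem isNormalMonoid_comap_blockDegree_iff (hα : ∀ i, 1 ≤ α i)
    (M : AddSubmonoid (Fin n →₀ ℕ)) :
    IsNormalMonoid (M.comap (blockDegree α)) ↔ IsNormalMonoid M := by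
  constructor
  · intro H w a ha haw k hk hkw
    have := H (firstVars hα w) (firstVars hα a)
    simp only [AddSubmonoid.mem_comap, map_add, map_nsmul, blockDegree_firstVars] at this
    exact this ha haw k hk hkw
  · intro H w a ha haw k hk hkw
    simp only [AddSubmonoid.mem_comap, map_add, map_nsmul] at ha haw hkw ⊢
    exact H _ _ ha haw k hk hkw

end Expansion

theorem mainTheorem6 {K : Type*} [Field K] {n : ℕ} (α : Fin n → ℕ) (hα : ∀ i, 1 ≤ α i)
    (A : Set (Fin n →₀ ℕ)) (hA : A.Finite) :
    IsIntegrallyClosed (Expansion.toricRing K A) ↔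
      IsIntegrallyClosed (Expansion.toricRing K (Expansion.expandSet K α A)) := by
  rw [Expansion.expandSet_eq_preimage, Expansion.isIntegrallyClosed_toricRing_iff hA,
    Expansion.isIntegrallyClosed_toricRing_iff (Expansion.finite_blockDegree_preimage hA),
    Expansion.closure_blockDegree_preimage, Expansion.isNormalMonoid_comap_blockDegree_iff hα]
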